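/- Let $a$ and $b$ be positive integers with $b\ge\max\{a,3\}$, and let $G$ be a finite simple undirected graph of order $n$ with $n\ge\max\{a+2,7\}$. Write $\delta(G)$ for the minimum degree and $e(G)$ for the number of edges of $G$. If $\delta(G)\ge a+1$ and $$e(G)\ \ge\ \binom{n-1}{2}+\frac{a+2}{2},$$ then $G$ is a fractional $[a,b]$-deleted graph; that is, for every edge $e$ of $G$ the graph $G-e$ contains a fractional $[a,b]$-factor, meaning that there is a function $h:E(G-e)\to[0,1]$ such that $$a\ \le\ \sum_{e'\in E_{G-e}(v)}h(e')\ \le\ b\qquad\text{for every }v\in V(G),$$ where $E_{G-e}(v)$ denotes the set of edges of $G-e$ incident with $v$. (The fractional $[a,b]$-factor with indicator function $h$ is the spanning subgraph of $G-e$ whose edges are those $e'$ with $h(e')>0$.) -/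

import Mathlib

/-- `h` is the indicator function of a fractional `(g,f)`-factor of `G`: it takes values in `[0,1]`
on the edges of `G`, and its sum over the set of edges incident with `v` lies in `[g v, f v]` for
every vertex `v`. Values of `h` off the edge set of `G` play no role. -/
def IsFractionalFactorIndicator {V : Type*} [Fintype V] (G : SimpleGraph V) (g f : V → ℕ)
    (h : Sym2 V → ℝ) : Prop :=
  open Classical in
  (∀ e ∈ G.edgeSet, 0 ≤ h e ∧ h e ≤ 1) ∧
    ∀ v : V, (g v : ℝ) ≤ ∑ e ∈ G.incidenceFinset v, h e ∧
      ∑ e ∈ G.incidenceFinset v, h e ≤ (f v : ℝ)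

/-- `F` is a fractional `(g,f)`-factor of `G`: the spanning subgraph whose edges are the edges `e`
of `G` with `h e > 0`, for an indicator function `h`. -/
def IsFractionalFactor {V : Type*} [Fintype V] (G : SimpleGraph V) (g f : V → ℕ)
    (F : SimpleGraph V) : Prop :=
  ∃ h : Sym2 V → ℝ, IsFractionalFactorIndicator G g f h ∧
    F.edgeSet = {e | e ∈ G.edgeSet ∧ 0 < h e}

/-- `G` is a fractional `(g,f)`-deleted graph: for every edge `e` of `G`, the graph `G - e`
contains a fractional `(g,f)`-factor. -/
def IsFractionalDeleted {V : Type*} [Fintype V] (G : SimpleGraph V) (g f : V → ℕ) : Prop :=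
  ∀ e ∈ G.edgeSet, ∃ F : SimpleGraph V, IsFractionalFactor (G.deleteEdges {e}) g f F

/-- `G` is a fractional `[a,b]`-deleted graph. -/
def IsFractionalIntervalDeleted {V : Type*} [Fintype V] (G : SimpleGraph V) (a b : ℕ) : Prop :=
  IsFractionalDeleted G (fun _ => a) (fun _ => b)

/-! Fractional factors are governed by a deficiency criterion: one exists if `a|T| ≤ b|S| + ∑_{v ∈
T} d_{G-S}(v)` for all disjoint `S`, `T`. Choose edge weights in `[0,1]` minimizing the sum of
squared distances from the vertex degrees to their intervals. If some degrees were out of range, the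
underfull set `T` and the overfull set `S` would violate the criterion
(`exists_isFractionalFactor_of_deficiency`).

The graph `H = G - e` has minimum degree at least `a` and few missing edges. A violating pair forces
`|T| > b`, and vertices of `T` have so few neighbours outside `S` that too many edges are missing,
except in small or extremal cases. These are excluded by `n ≥ 7` and by the case where `G` is
complete (`exists_isFractionalFactor_of_sum_codegree`). -/

open Classical in
/-- The sum of the weights `h` of the edges of `G` at `v`. -/
noncomputable def fractionalDegree {V : Type*} [Fintype V] (G : SimpleGraph V)
    (h : Sym2 V → ℝ) (v : V) : ℝ :=
  ∑ u, if G.Adj v u then h s(v, u) else 0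

open Classical in
theorem sum_incidenceFinset_eq_fractionalDegree {V : Type*} [Fintype V] (G : SimpleGraph V)
    (h : Sym2 V → ℝ) (v : V) :
    ∑ e ∈ G.incidenceFinset v, h e = fractionalDegree G h v := by
  rw [fractionalDegree, ← Finset.sum_filter]
  symm
  refine Finset.sum_bij (fun u _ => s(v, u)) ?_ ?_ ?_ (fun _ _ => rfl)
  · intro u hu
    simpa [SimpleGraph.mem_incidenceSet] using hu
  · intro u _ w _ huw
    exact Sym2.congr_right.1 huw
  · intro e he
    rw [SimpleGraph.mem_incidenceFinset] at he
    obtain ⟨u, rfl⟩ := Sym2.mem_iff_exists.1 he.2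
    exact ⟨u, by simpa using he.1, rfl⟩

open Classical in
theorem fractionalDegree_update {V : Type*} [Fintype V] {G : SimpleGraph V} (h : Sym2 V → ℝ)
    {u v : V} (huv : G.Adj u v) (c : ℝ) (w : V) :
    fractionalDegree G (Function.update h s(u, v) (h s(u, v) + c)) w =
      fractionalDegree G h w + if w = u ∨ w = v then c else 0 := by
  have key : ∀ x, (if G.Adj w x then Function.update h s(u, v) (h s(u, v) + c) s(w, x) else 0) =
      (if G.Adj w x then h s(w, x) else 0) + if s(w, x) = s(u, v) then c else 0 := by
    intro x
    by_cases hx : s(w, x) = s(u, v)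
    · have hwx : G.Adj w x := by
        rw [← SimpleGraph.mem_edgeSet, hx]
        exact huv
      simp [hx, hwx]
    · simp [hx]
  rw [fractionalDegree, Finset.sum_congr rfl fun x _ => key x, Finset.sum_add_distrib,
    ← fractionalDegree]
  congr 1
  by_cases hu : w = u
  · subst hu
    simp only [Sym2.congr_right]
    simp
  · by_cases hv : w = v
    · subst hv
      simp [hu]
    · simp [hu, hv]

theorem continuous_fractionalDegree {V : Type*} [Fintype V] (G : SimpleGraph V) (v : V) :
    Continuous fun h : Sym2 V → ℝ => fractionalDegree G h v := by
  classical
  unfold fractionalDegree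
  refine continuous_finsetSum _ fun u _ => ?_
  split_ifs <;> fun_prop

/-! ### Penalty minimization -/

/-- The squared distance from `d` to the interval `[p, q]`. -/
def intervalPenalty (p q d : ℝ) : ℝ := max (p - d) 0 ^ 2 + max (d - q) 0 ^ 2

theorem intervalPenalty_reflect (p q d : ℝ) :
    intervalPenalty (-q) (-p) (-d) = intervalPenalty p q d := by
  unfold intervalPenalty
  rw [show -q - -d = d - q by ring, show -d - -p = p - d by ring, add_comm]

/-- The first penalty drops by `c * (2 * (p - d) - c) ≥ 3 * c ^ 2`, while the second grows by at
most `c ^ 2` because `d'` starts no higher than `q'`. -/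
theorem intervalPenalty_add_lt {p q p' q' d d' c : ℝ} (hpq : p ≤ q) (hd : d < p)
    (hd' : d' ≤ q') (hc : 0 < c) (hcd : c ≤ (p - d) / 2) :
    intervalPenalty p q (d + c) + intervalPenalty p' q' (d' + c) <
      intervalPenalty p q d + intervalPenalty p' q' d' := by
  have h1 : intervalPenalty p q (d + c) = (p - d - c) ^ 2 := by
    rw [intervalPenalty, max_eq_left (by linarith), max_eq_right (by linarith)]
    ring
  have h2 : intervalPenalty p q d = (p - d) ^ 2 := by
    rw [intervalPenalty, max_eq_left (by linarith), max_eq_right (by linarith)]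
    ring
  have h3 : intervalPenalty p' q' (d' + c) ≤ intervalPenalty p' q' d' + c ^ 2 := by
    unfold intervalPenalty
    have e1 : max (p' - (d' + c)) 0 ^ 2 ≤ max (p' - d') 0 ^ 2 :=
      pow_le_pow_left₀ (le_max_right _ _) (max_le_max (by linarith) le_rfl) 2
    have e2 : max (d' + c - q') 0 ^ 2 ≤ c ^ 2 :=
      pow_le_pow_left₀ (le_max_right _ _) (max_le (by linarith) hc.le) 2
    nlinarith [sq_nonneg (max (d' - q') 0)]
  rw [h1, h2]
  nlinarith

theorem intervalPenalty_sub_lt {p q p' q' d d' c : ℝ} (hpq : p ≤ q)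
    (hd' : p' ≤ d') (hc : 0 < c) (hcd : c ≤ (d - q) / 2) :
    intervalPenalty p q (d + -c) + intervalPenalty p' q' (d' + -c) <
      intervalPenalty p q d + intervalPenalty p' q' d' := by
  rw [← intervalPenalty_reflect p q, ← intervalPenalty_reflect p' q',
    ← intervalPenalty_reflect p q d, ← intervalPenalty_reflect p' q' d', neg_add, neg_add, neg_neg]
  exact intervalPenalty_add_lt (by linarith) (by linarith) (by linarith) hc (by linarith)

/-- Weights in `[0,1]` minimizing the total penalty: no single edge can be changed profitably. -/
theorem exists_locally_optimal_weights {V : Type*} [Fintype V] (G : SimpleGraph V)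
    (p q : V → ℝ) :
    ∃ h : Sym2 V → ℝ, (∀ e, 0 ≤ h e ∧ h e ≤ 1) ∧
      ∀ u v c, G.Adj u v → 0 ≤ h s(u, v) + c → h s(u, v) + c ≤ 1 →
        intervalPenalty (p u) (q u) (fractionalDegree G h u) +
            intervalPenalty (p v) (q v) (fractionalDegree G h v) ≤
          intervalPenalty (p u) (q u) (fractionalDegree G h u + c) +
            intervalPenalty (p v) (q v) (fractionalDegree G h v + c) := by
  classical
  obtain ⟨h, hK, hmin⟩ := (isCompact_Icc (a := (0 : Sym2 V → ℝ)) (b := 1)).exists_isMinOn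
    ⟨0, by simp⟩
    (f := fun h => ∑ v, intervalPenalty (p v) (q v) (fractionalDegree G h v)) (by
      refine Continuous.continuousOn (continuous_finsetSum _ fun v _ => ?_)
      have := continuous_fractionalDegree G v
      unfold intervalPenalty
      fun_prop)
  have hbd : ∀ e, 0 ≤ h e ∧ h e ≤ 1 := fun e => ⟨hK.1 e, hK.2 e⟩
  refine ⟨h, hbd, fun u v c huv h0 h1 => ?_⟩
  have hmem : Function.update h s(u, v) (h s(u, v) + c) ∈ Set.Icc (0 : Sym2 V → ℝ) 1 := by
    constructor <;> intro e <;> by_cases he : e = s(u, v)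
    · subst he; simpa using h0
    · simpa [he] using (hbd e).1
    · subst he; simpa using h1
    · simpa [he] using (hbd e).2
  have hle := hmin hmem
  simp only [Set.mem_ofPred_eq, fractionalDegree_update h huv] at hle
  have hv : v ∈ Finset.univ.erase u := by simp [huv.ne']
  rw [← Finset.add_sum_erase _ _ (Finset.mem_univ u), ← Finset.add_sum_erase _ _ hv,
    ← Finset.add_sum_erase _ _ (Finset.mem_univ u), ← Finset.add_sum_erase _ _ hv] at hle
  have hrest : ∑ x ∈ (Finset.univ.erase u).erase v, intervalPenalty (p x) (q x)
        (fractionalDegree G h x + if x = u ∨ x = v then c else 0) =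
      ∑ x ∈ (Finset.univ.erase u).erase v,
        intervalPenalty (p x) (q x) (fractionalDegree G h x) := by
    refine Finset.sum_congr rfl fun x hx => ?_
    simp only [Finset.mem_erase] at hx
    simp [hx.1, hx.2.1]
  rw [hrest] at hle
  simp only [true_or, or_true, if_true] at hle
  linarith

/-! ### The deficiency criterion -/

open Classical in
/-- The sufficiency half of the criterion for fractional `(g,f)`-factors. -/
theorem exists_isFractionalFactor_of_deficiency {V : Type*} [Fintype V] (G : SimpleGraph V)
    (g f : V → ℕ) (hgf : ∀ v, g v ≤ f v)
    (hcrit : ∀ S T : Finset V, Disjoint S T →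
      ∑ v ∈ T, g v ≤ ∑ v ∈ S, f v + ∑ v ∈ T, (G.neighborFinset v \ S).card) :
    ∃ F : SimpleGraph V, IsFractionalFactor G g f F := by
  obtain ⟨h, hbd, hopt⟩ :=
    exists_locally_optimal_weights G (fun v => (g v : ℝ)) (fun v => (f v : ℝ))
  have hgf' : ∀ v, (g v : ℝ) ≤ f v := fun v => by exact_mod_cast hgf v
  have hone : ∀ u v, G.Adj u v → fractionalDegree G h u < g u → fractionalDegree G h v ≤ f v →
      h s(u, v) = 1 := by
    intro u v huv hu hv
    by_contra hne
    have hlt : h s(u, v) < 1 := lt_of_le_of_ne (hbd _).2 hne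
    obtain ⟨c, hc, hcm⟩ := exists_between
      (lt_min (sub_pos.2 hlt) (half_pos (sub_pos.2 hu)))
    have hc1 := hcm.trans_le (min_le_left _ _)
    have hc2 := hcm.trans_le (min_le_right _ _)
    have := hopt u v c huv (by linarith [(hbd s(u, v)).1]) (by linarith)
    exact this.not_gt (intervalPenalty_add_lt (hgf' u) hu hv hc hc2.le)
  have hzero : ∀ u v, G.Adj u v → (f u : ℝ) < fractionalDegree G h u →
      (g v : ℝ) ≤ fractionalDegree G h v → h s(u, v) = 0 := by
    intro u v huv hu hv
    by_contra hne
    have hlt : 0 < h s(u, v) := lt_of_le_of_ne (hbd _).1 (Ne.symm hne)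
    obtain ⟨c, hc, hcm⟩ := exists_between (lt_min hlt (half_pos (sub_pos.2 hu)))
    have hc1 := hcm.trans_le (min_le_left _ _)
    have hc2 := hcm.trans_le (min_le_right _ _)
    have := hopt u v (-c) huv (by linarith) (by linarith [(hbd s(u, v)).2])
    exact this.not_gt (intervalPenalty_sub_lt (hgf' u) hv hc hc2.le)
  -- By optimality, edges from the underfull set `T` to vertices outside `S` have weight 1, and
  -- edges from the overfull set `S` to vertices outside `T` have weight 0.
  set T : Finset V := {v | fractionalDegree G h v < g v} with hT
  set S : Finset V := {v | (f v : ℝ) < fractionalDegree G h v} with hS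
  have hmT : ∀ v, v ∈ T ↔ fractionalDegree G h v < g v := fun v => by simp [hT]
  have hmS : ∀ v, v ∈ S ↔ (f v : ℝ) < fractionalDegree G h v := fun v => by simp [hS]
  have hdisj : Disjoint S T := by
    rw [Finset.disjoint_left]
    intro v h1 h2
    rw [hmS] at h1
    rw [hmT] at h2
    linarith [hgf' v]
  let w : V → V → ℝ := fun v u => if G.Adj v u then h s(v, u) else 0
  have hw : ∀ v u, w v u = w u v := fun v u => by
    simp only [w, G.adj_comm v u, Sym2.eq_swap (a := v)]
  have hTdeg : ∀ v ∈ T, fractionalDegree G h v =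
      ∑ u ∈ S, w v u + ((G.neighborFinset v \ S).card : ℝ) := by
    intro v hv
    rw [fractionalDegree, ← Finset.sum_add_sum_compl S]
    congr 1
    have : ∀ u ∈ Sᶜ, (if G.Adj v u then h s(v, u) else 0) = if G.Adj v u then (1 : ℝ) else 0 := by
      intro u hu
      by_cases hvu : G.Adj v u
      · rw [if_pos hvu, if_pos hvu]
        refine hone v u hvu ((hmT v).1 hv) (not_lt.1 fun hlt => ?_)
        exact (Finset.mem_compl.1 hu) ((hmS u).2 hlt)
      · simp [hvu]
    rw [Finset.sum_congr rfl this, Finset.sum_boole]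
    congr 2
    ext u
    simp [and_comm]
  have hSdeg : ∀ v ∈ S, fractionalDegree G h v = ∑ u ∈ T, w v u := by
    intro v hv
    rw [fractionalDegree, ← Finset.sum_add_sum_compl T, add_eq_left]
    refine Finset.sum_eq_zero fun u hu => ?_
    by_cases hvu : G.Adj v u
    · rw [if_pos hvu]
      refine hzero v u hvu ((hmS v).1 hv) (not_lt.1 fun hlt => ?_)
      exact (Finset.mem_compl.1 hu) ((hmT u).2 hlt)
    · simp [hvu]
  -- The weight between `S` and `T` is all of the degree sum over `S`, so it cancels by double
  -- counting.
  have hsumT : ∑ v ∈ T, fractionalDegree G h v =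
      ∑ v ∈ S, fractionalDegree G h v + ∑ v ∈ T, ((G.neighborFinset v \ S).card : ℝ) := by
    rw [Finset.sum_congr rfl hTdeg, Finset.sum_add_distrib, Finset.sum_congr rfl hSdeg,
      Finset.sum_comm]
    simp only [hw]
  have hcrit' : ∑ v ∈ T, (g v : ℝ) ≤
      ∑ v ∈ S, (f v : ℝ) + ∑ v ∈ T, ((G.neighborFinset v \ S).card : ℝ) := by
    exact_mod_cast hcrit S T hdisj
  have hTle : ∑ v ∈ T, fractionalDegree G h v ≤ ∑ v ∈ T, (g v : ℝ) :=
    Finset.sum_le_sum fun v hv => ((hmT v).1 hv).le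
  have hSle : ∑ v ∈ S, (f v : ℝ) ≤ ∑ v ∈ S, fractionalDegree G h v :=
    Finset.sum_le_sum fun v hv => ((hmS v).1 hv).le
  have hTempty : T = ∅ := by
    by_contra hne
    have := Finset.sum_lt_sum_of_nonempty (Finset.nonempty_iff_ne_empty.2 hne)
      fun v hv => (hmT v).1 hv
    linarith
  have hSempty : S = ∅ := by
    by_contra hne
    have := Finset.sum_lt_sum_of_nonempty (Finset.nonempty_iff_ne_empty.2 hne)
      fun v hv => (hmS v).1 hv
    linarith
  refine ⟨SimpleGraph.fromEdgeSet {e | e ∈ G.edgeSet ∧ 0 < h e}, h, ⟨fun e _ => hbd e, ?_⟩, ?_⟩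
  · intro v
    rw [sum_incidenceFinset_eq_fractionalDegree]
    constructor
    · exact not_lt.1 fun hlt => by simpa [hTempty] using (hmT v).2 hlt
    · exact not_lt.1 fun hlt => by simpa [hSempty] using (hmS v).2 hlt
  · rw [SimpleGraph.edgeSet_fromEdgeSet]
    refine sdiff_eq_left.2 (Set.disjoint_left.2 fun e he hd => ?_)
    exact G.not_isDiag_of_mem_edgeSet he.1 hd

/-! ### Graphs with few missing edges -/

open Classical in
theorem degree_le_degree_deleteEdges_singleton_add_one {V : Type*} [Fintype V]
    (G : SimpleGraph V) (e : Sym2 V) (v : V) :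
    G.degree v ≤ (G.deleteEdges {e}).degree v + 1 := by
  induction e with | _ x y =>
  have hsub : G.neighborFinset v ⊆
      insert (if v = x then y else x) ((G.deleteEdges {s(x, y)}).neighborFinset v) := by
    intro u hu
    have hvu : G.Adj v u := by simpa using hu
    simp only [Finset.mem_insert, SimpleGraph.mem_neighborFinset, SimpleGraph.deleteEdges_adj,
      Set.mem_singleton_iff, Sym2.eq_iff]
    split_ifs <;> grind
  rw [← SimpleGraph.card_neighborFinset_eq_degree, ← SimpleGraph.card_neighborFinset_eq_degree]
  exact (Finset.card_le_card hsub).trans (Finset.card_insert_le _ _)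

open Classical in
/-- A graph of minimum degree at least `a` missing few edges has a fractional `[a,b]`-factor. -/
theorem exists_isFractionalFactor_of_sum_codegree {V : Type*} [Fintype V] (H : SimpleGraph V)
    (a b : ℕ) (ha : a ≤ b) (hb : 3 ≤ b) (hn : 7 ≤ Fintype.card V)
    (hδ : ∀ v, a ≤ H.degree v)
    (hD : ∑ v, ((Fintype.card V : ℤ) - 1 - H.degree v) ≤ 2 * Fintype.card V - 2 - a)
    (hD' : Fintype.card V = a + 2 → ∑ v, ((Fintype.card V : ℤ) - 1 - H.degree v) ≤ 2) :
    ∃ F : SimpleGraph V, IsFractionalFactor H (fun _ => a) (fun _ => b) F := by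
  refine exists_isFractionalFactor_of_deficiency H _ _ (fun _ => ha) fun S T hST => ?_
  by_contra! hlt
  simp only [Finset.sum_const, smul_eq_mul] at hlt
  have hst : S.card + T.card ≤ Fintype.card V := by
    rw [← Finset.card_union_of_disjoint hST]
    exact Finset.card_le_univ _
  have hq : ∀ v, H.degree v ≤ (H.neighborFinset v \ S).card + S.card := fun v => by
    rw [← SimpleGraph.card_neighborFinset_eq_degree]
    exact Finset.card_le_card_sdiff_add_card
  have hqa : T.card * a ≤ ∑ v ∈ T, (H.neighborFinset v \ S).card + T.card * S.card := by
    have := Finset.sum_le_sum fun v (_ : v ∈ T) => (hδ v).trans (hq v)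
    simpa [Finset.sum_add_distrib] using this
  have hqD : (T.card : ℤ) * (Fintype.card V - 1 - S.card) -
      ∑ v ∈ T, ((H.neighborFinset v \ S).card : ℤ) ≤
        ∑ v, ((Fintype.card V : ℤ) - 1 - H.degree v) := by
    calc _ = ∑ v ∈ T, ((Fintype.card V : ℤ) - 1 - S.card - (H.neighborFinset v \ S).card) := by
          rw [Finset.sum_sub_distrib, Finset.sum_const, nsmul_eq_mul]
      _ ≤ ∑ v ∈ T, ((Fintype.card V : ℤ) - 1 - H.degree v) :=
          Finset.sum_le_sum fun v _ => by have := hq v; omega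
      _ ≤ _ := Finset.sum_le_sum_of_subset_of_nonneg (Finset.subset_univ _) fun v _ _ => by
          have := H.degree_lt_card_verts v
          omega
  -- Writing `s = |S|`, `t = |T|` and `Q = ∑_{v ∈ T} d_{H-S}(v)`, one has `b s + Q < a t ≤ Q + t s`.
  have hbt : b < T.card := by
    by_contra! hle
    have := Nat.mul_le_mul_right S.card hle
    nlinarith
  rw [← Nat.cast_sum] at hqD
  generalize (∑ v ∈ T, (H.neighborFinset v \ S).card) = Q at *
  generalize (∑ v, ((Fintype.card V : ℤ) - 1 - H.degree v)) = D at *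
  generalize Fintype.card V = n at *
  generalize S.card = s at *
  generalize T.card = t at *
  have hs : 1 ≤ s := by
    by_contra! h0
    obtain rfl : s = 0 := by omega
    omega
  -- Here `n ≥ s + t ≥ s + b + 1 ≥ s + a + 1`; the excess `k` turns out to be 0.
  obtain ⟨k, rfl⟩ : ∃ k, n = a + s + 1 + k := ⟨n - (a + s + 1), by omega⟩
  have hmain : t * k + s * b + 1 ≤ 2 * k + 2 * s + a := by
    zify at hlt ⊢
    push_cast at hqD hD
    nlinarith
  have h1 : (b + 1) * k ≤ t * k := Nat.mul_le_mul_right k hbt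
  have hk : k = 0 := by
    by_contra hk
    have : 1 ≤ k := by omega
    nlinarith
  subst hk
  have hs1 : s = 1 := by
    by_contra hs1
    have : 2 ≤ s := by omega
    have hb3 : b = 3 ∧ s = 2 := by
      constructor
      · by_contra
        have : 4 ≤ b := by omega
        nlinarith
      · by_contra
        have : 3 ≤ s := by omega
        nlinarith
    -- With `b = 3`, `s = 2` and `k = 0`, the order is `a + 3 ≤ 6`, against `n ≥ 7`.
    omega
  subst hs1
  have hab : b = a := by omega
  subst hab
  have ht : t = b + 1 := by omega
  subst ht
  -- Now `n = a + 2`: the codegree sum is at most 2, but the violation makes it at least `b + 1`.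
  have := hD' (by ring)
  push_cast at hqD
  zify at hlt hn
  nlinarith

theorem theorem1p8 {V : Type*} [Fintype V] [DecidableEq V] (G : SimpleGraph V)
    [DecidableRel G.Adj] (a b : ℕ) (ha : 1 ≤ a) (hb : max a 3 ≤ b)
    (hn : max (a + 2) 7 ≤ Fintype.card V)
    (hδ : a + 1 ≤ G.minDegree)
    (he : ((Fintype.card V - 1).choose 2 : ℝ) + ((a : ℝ) + 2) / 2 ≤ (G.edgeFinset.card : ℝ)) :
    IsFractionalIntervalDeleted G a b := by
  classical
  intro e heG
  have hdeg : ∀ v, a + 1 ≤ G.degree v := fun v => hδ.trans (G.minDegree_le_degree v)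
  have hle : ∀ v, G.degree v ≤ (G.deleteEdges {e}).degree v + 1 := fun v => by
    convert degree_le_degree_deleteEdges_singleton_add_one G e v
  have hcard : (G.deleteEdges {e}).edgeFinset.card + 1 = G.edgeFinset.card := by
    have : (G.deleteEdges {e}).edgeFinset = G.edgeFinset.erase e := by
      ext x
      simp [SimpleGraph.edgeSet_deleteEdges, and_comm]
    rw [this]
    exact Finset.card_erase_add_one (SimpleGraph.mem_edgeFinset.2 heG)
  have hsum := (G.deleteEdges {e}).sum_degrees_eq_twice_card_edges
  have hsumG := G.sum_degrees_eq_twice_card_edges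
  have hD : ∑ v, ((Fintype.card V : ℤ) - 1 - (G.deleteEdges {e}).degree v) =
      Fintype.card V * (Fintype.card V - 1) - 2 * (G.edgeFinset.card - 1) := by
    rw [Finset.sum_sub_distrib, ← Nat.cast_sum, hsum, ← hcard]
    simp
    ring
  obtain ⟨n, hn'⟩ : ∃ n, Fintype.card V = n + 2 := ⟨Fintype.card V - 2, by omega⟩
  have hbound : ∑ v, ((Fintype.card V : ℤ) - 1 - (G.deleteEdges {e}).degree v) ≤
      2 * Fintype.card V - 2 - a := by
    rw [hD, hn']
    rw [hn', Nat.cast_choose_two] at he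
    push_cast at he ⊢
    have : ((n : ℝ) + 1) * n + a + 2 ≤ 2 * G.edgeFinset.card := by
      linarith
    have : ((n : ℤ) + 1) * n + a + 2 ≤ 2 * G.edgeFinset.card := by exact_mod_cast this
    linarith
  -- When `n = a + 2` the degree condition makes `G` complete, so `G - e` misses only `e`.
  have hbound' : Fintype.card V = a + 2 →
      ∑ v, ((Fintype.card V : ℤ) - 1 - (G.deleteEdges {e}).degree v) ≤ 2 := by
    intro h2
    have : Fintype.card V * (a + 1) ≤ ∑ v, G.degree v := by
      have := Finset.sum_le_sum fun v (_ : v ∈ Finset.univ) => hdeg v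
      simpa using this
    rw [hsumG, h2] at this
    rw [hD, h2]
    zify at this
    push_cast
    linarith
  have hmin : ∀ v, a ≤ (G.deleteEdges {e}).degree v := fun v => by
    have := hdeg v
    have := hle v
    omega
  refine exists_isFractionalFactor_of_sum_codegree _ a b (by omega) (by omega) (by omega) ?_ ?_ ?_
  · convert hmin
  · convert hbound
  · convert hbound'
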